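/- Order $\mathbb R^3$ componentwise, with positive cone $\mathbb R^3_+$. For $A\subset\mathbb R^3$, a linear subspace $M\subset\mathbb R^3$ and a linear functional $\pi:M\to\mathbb R$ put \[ \rho(x)=\inf\{\pi(z)\,;\ z\in M,\ z+x\in A\}\in[-\infty,\infty],\qquad \mathcal R(x)=\{z\in M\,;\ z+x\in A,\ \pi(z)=\rho(x)\}\qquad(x\in\mathbb R^3). \] A selection of $\mathcal R$ is a map $s:\mathbb R^3\to M$ with $s(x)\in\mathcal R(x)$ for all $x$. The triple $(A,M,\pi)$ is called admissible if (R1) $A$ is closed, convex, contains $0$, and $x\in A$, $y\in x+\mathbb R^3_+$ imply $y\in A$; (R2) $\pi(z)>0$ for every $z\in (M\cap\mathbb R^3_+)\setminus\{0\}$; (R3) $\rho$ is finite and continuous. Let $C=E_1\cup E_2\cup E_3\cup E_4\subset\mathbb R^2$, where \[ \begin{aligned} E_1&=\{4(u-\tfrac12)^2+v^2\le 1,\ u\in[\tfrac12,1],\ v\in[0,1]\}, & E_2&=\{\tfrac49(u-\tfrac12)^2+v^2\le 1,\ u\in[-1,\tfrac12],\ v\in[0,1]\},\\ E_3&=\{4(u+\tfrac12)^2+v^2\le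 1,\ u\in[-1,-\tfrac12],\ v\in[-1,0]\}, & E_4&=\{\tfrac49(u+\tfrac12)^2+v^2\le 1,\ u\in[-\tfrac12,1],\ v\in[-1,0]\}. \end{aligned} \] Let $r=16$, \[ B_r(C)=\{(u\sqrt{1+r^2t},\,v\,r\sqrt t,\,t)\,;\ (u,v)\in C,\ t\in[0,1]\},\qquad \Phi(x)=\begin{pmatrix}\tfrac1{\sqrt2}&\tfrac1{\sqrt6}&\tfrac1{\sqrt3}\\-\tfrac1{\sqrt2}&\tfrac1{\sqrt6}&\tfrac1{\sqrt3}\\0&-\tfrac{\sqrt2}{\sqrt3}&\tfrac1{\sqrt3}\end{pmatrix}x, \] and let $A=\Phi(B_{16}(C))+\mathbb R^3_+$, $M=\Phi(\{w\in\mathbb R^3\,;\ w_2=0\})$ and $\pi(z)=z_3$ for $z\in M$. Then: (a) $(A,M,\pi)$ is admissible, $\rho$ is Lipschitz continuous, and $\mathcal R(x)\neq\emptyset$ for every $x\in\mathbb R^3$. (b) For $n\ge1$ let $y^{(2n-1)}=(0,-\tfrac{r}{\sqrt n},0)$ and $y^{(2n)}=(0,\tfrac{r}{\sqrt n},0)$.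 Then $\Phi(y^{(k)})\to0$ as $k\to\infty$ and, for every $n\ge1$, \[ \mathcal R(\Phi(y^{(2n-1)}))=\Big\{\Phi\Big(-\tfrac12\sqrt{1+\tfrac{r^2}{n}},\,0,\,\tfrac1n\Big)\Big\},\qquad \mathcal R(\Phi(y^{(2n)}))=\Big\{\Phi\Big(\tfrac12\sqrt{1+\tfrac{r^2}{n}},\,0,\,\tfrac1n\Big)\Big\}. \] As $n\to\infty$ these optimal payoffs converge to $\Phi(-\tfrac12,0,0)$ and $\Phi(\tfrac12,0,0)$ respectively, and these two limits are different. (c) No selection of $\mathcal R$ is continuous at $0$. -/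

import Mathlib

open scoped Pointwise

noncomputable section

namespace RiskSelection

/-! ### The optimal value function, the optimal set mapping, admissible triples -/

section General

variable {X : Type*} [AddCommGroup X] [Module ℝ X]

/-- The optimal value function `ρ(x) = inf {π(z) ; z ∈ M, z + x ∈ A}`, with values in the
extended reals (the infimum of the empty set is `⊤`). -/
def riskMeasure (A : Set X) (M : Submodule ℝ X) (price : M →ₗ[ℝ] ℝ) (x : X) : EReal :=
  sInf {c : EReal | ∃ z : M, (z : X) + x ∈ A ∧ c = ((price z : ℝ) : EReal)}

/-- The optimal set mapping `x ↦ {z ∈ M ; z + x ∈ A, π(z) = ρ(x)}`, with values subsets of `M`. -/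
def optimalSet (A : Set X) (M : Submodule ℝ X) (price : M →ₗ[ℝ] ℝ) (x : X) : Set M :=
  {z : M | (z : X) + x ∈ A ∧ ((price z : ℝ) : EReal) = riskMeasure A M price x}

/-- A selection of a set-valued map. -/
def IsSelection {S T : Type*} (F : S → Set T) (s : S → T) : Prop :=
  ∀ x, s x ∈ F x

/-- Admissible triples `(A, M, π)`; the positive cone is `{x ; 0 ≤ x}`. -/
structure Admissible [TopologicalSpace X] [PartialOrder X]
    (A : Set X) (M : Submodule ℝ X) (price : M →ₗ[ℝ] ℝ) : Prop where
  isClosed : IsClosed A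
  convex : Convex ℝ A
  zero_mem : (0 : X) ∈ A
  monotone : ∀ x ∈ A, ∀ y, 0 ≤ y - x → y ∈ A
  noArbitrage : ∀ z : M, 0 ≤ (z : X) → (z : X) ≠ 0 → 0 < price z
  finite : ∀ x, riskMeasure A M price x ≠ ⊥ ∧ riskMeasure A M price x ≠ ⊤
  continuous : Continuous (riskMeasure A M price)

end General

/-! ### The example in `ℝ³`

`ℝ³` is `Fin 3 → ℝ` with its componentwise order; the coordinates `x₁, x₂, x₃` are
`x 0, x 1, x 2`. -/

/-- The set `B_r(E) = {(u √(1 + r² t), v r √t, t) ; (u, v) ∈ E, t ∈ [0, 1]}`. -/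
def twistedSet (r : ℝ) (E : Set (ℝ × ℝ)) : Set (Fin 3 → ℝ) :=
  {x | ∃ u v t : ℝ, (u, v) ∈ E ∧ t ∈ Set.Icc (0 : ℝ) 1 ∧
    x = ![u * √(1 + r ^ 2 * t), v * r * √t, t]}

def quarter1 : Set (ℝ × ℝ) :=
  {p | 4 * (p.1 - 1 / 2) ^ 2 + p.2 ^ 2 ≤ 1 ∧
    p.1 ∈ Set.Icc (1 / 2 : ℝ) 1 ∧ p.2 ∈ Set.Icc (0 : ℝ) 1}

def quarter2 : Set (ℝ × ℝ) :=
  {p | 4 / 9 * (p.1 - 1 / 2) ^ 2 + p.2 ^ 2 ≤ 1 ∧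
    p.1 ∈ Set.Icc (-1 : ℝ) (1 / 2) ∧ p.2 ∈ Set.Icc (0 : ℝ) 1}

def quarter3 : Set (ℝ × ℝ) :=
  {p | 4 * (p.1 + 1 / 2) ^ 2 + p.2 ^ 2 ≤ 1 ∧
    p.1 ∈ Set.Icc (-1 : ℝ) (-(1 / 2)) ∧ p.2 ∈ Set.Icc (-1 : ℝ) 0}

def quarter4 : Set (ℝ × ℝ) :=
  {p | 4 / 9 * (p.1 + 1 / 2) ^ 2 + p.2 ^ 2 ≤ 1 ∧
    p.1 ∈ Set.Icc (-(1 / 2) : ℝ) 1 ∧ p.2 ∈ Set.Icc (-1 : ℝ) 0}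

/-- The set `C`, the union of four quarters of ellipses. -/
def fourQuarters : Set (ℝ × ℝ) :=
  quarter1 ∪ quarter2 ∪ quarter3 ∪ quarter4

/-- The rotation `Φ`. -/
def rotationPhi : (Fin 3 → ℝ) →ₗ[ℝ] (Fin 3 → ℝ) :=
  Matrix.toLin' !![1 / √2, 1 / √6, 1 / √3;
    -(1 / √2), 1 / √6, 1 / √3;
    0, -(√2 / √3), 1 / √3]

/-- The acceptance set `Φ(B_16(C)) + ℝ³₊`. -/
def acceptanceSet : Set (Fin 3 → ℝ) :=
  rotationPhi '' twistedSet 16 fourQuarters + {p : Fin 3 → ℝ | 0 ≤ p}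

/-- The payoff space `Φ({w ; w₂ = 0})`. -/
def payoffSpace : Submodule ℝ (Fin 3 → ℝ) :=
  (LinearMap.ker (LinearMap.proj (R := ℝ) (φ := fun _ : Fin 3 => ℝ) 1)).map rotationPhi

/-- The pricing functional `z ↦ z₃` on the payoff space. -/
def pricing : payoffSpace →ₗ[ℝ] ℝ :=
  (LinearMap.proj (R := ℝ) (φ := fun _ : Fin 3 => ℝ) 2).domRestrict payoffSpace

/-- The sequence `y^(2n-1) = (0, -16/√n, 0)`, `y^(2n) = (0, 16/√n, 0)`, for `n ≥ 1`. -/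
def perturbation (k : ℕ) : Fin 3 → ℝ :=
  if Even k then ![0, 16 / √((k : ℝ) / 2), 0] else ![0, -(16 / √(((k : ℝ) + 1) / 2)), 0]

end RiskSelection

end

open RiskSelection

/-!
Membership in `C` is equivalent to all the support inequalities `a u + b v ≤ h a b`, and the slice
of `B_r(C)` at height `t` has support function `h (a √(1 + s)) (b √s)` with `s = r² t`. This is
concave in `s`, so `B_r(C)` is convex: if `a b ≥ 0` it is a positive combination of square roots of
affine functions, and if `a b ≤ 0` it is half of `√(p + q s) - |a| √(1 + s)` with `p ≤ q` and
`a² ≤ q`.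

`Φ⁻¹` maps the orthant into the circular cone `k₁² + k₂² ≤ 2 k₃²`. If `Φ(a, ± r √τ, c)` is
acceptable, then `(a, ± r √τ, c)` minus a point of `B_r(C)` at some height `t ≤ c` lies in this
cone. As `|v| ≤ 1` on `C` and `r² ≥ 8`, this gives `2 (√τ - √t) ≤ c - t`, hence `τ ≤ c`, and
`c = τ` forces `t = τ` and `v = ± 1`. The only point of `C` with `v = ± 1` is `± (1/2, 1)`. So the
optimal payoff at `Φ(0, ± r √τ, 0)` is unique, and its first coordinate changes sign with the
perturbation while tending to `± 1/2`.
-/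

namespace RiskSelection

open Filter Set Topology

section Selection

variable {S T Y ι : Type*} [TopologicalSpace S] [TopologicalSpace T] [TopologicalSpace Y]
  [T2Space Y]

lemma IsSelection.apply_eq_of_tendsto {F : S → Set T} {s : S → T} (hs : IsSelection F s) {x : S}
    (hsx : ContinuousAt s x) {g : T → Y} (hg : ContinuousAt g (s x)) {l : Filter ι} [l.NeBot]
    {p : ι → S} (hp : Tendsto p l (𝓝 x)) {y : ι → Y} {b : Y} (hy : Tendsto y l (𝓝 b))
    (hF : ∀ᶠ n in l, g '' F (p n) ⊆ {y n}) : g (s x) = b := by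
  have hgs : Tendsto (fun n => g (s (p n))) l (𝓝 (g (s x))) :=
    hg.tendsto.comp (hsx.tendsto.comp hp)
  exact tendsto_nhds_unique
    (hgs.congr' (hF.mono fun n hn => hn (mem_image_of_mem g (hs (p n))))) hy

end Selection

section OptimalSet

variable {X : Type*} [AddCommGroup X] [Module ℝ X] {A : Set X} {M : Submodule ℝ X}
  {price : M →ₗ[ℝ] ℝ} {x : X} {z : M}

lemma mem_optimalSet_iff :
    z ∈ optimalSet A M price x ↔
      (z : X) + x ∈ A ∧ ∀ z' : M, (z' : X) + x ∈ A → price z ≤ price z' := by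
  refine and_congr_right fun hz => ⟨fun h z' hz' => ?_, fun hmin => ?_⟩
  · rw [← EReal.coe_le_coe_iff, h]
    exact sInf_le ⟨z', hz', rfl⟩
  · refine le_antisymm (le_sInf ?_) (sInf_le ⟨z, hz, rfl⟩)
    rintro _ ⟨z', hz', rfl⟩
    exact EReal.coe_le_coe_iff.2 (hmin z' hz')

lemma coe_toReal_riskMeasure (h : (optimalSet A M price x).Nonempty) :
    ((riskMeasure A M price x).toReal : EReal) = riskMeasure A M price x := by
  obtain ⟨z, -, hz⟩ := h
  rw [← hz, EReal.toReal_coe]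

end OptimalSet

section StrictlyPositivePricing

variable {ι : Type*} [Fintype ι] {A : Set (ι → ℝ)} {M : Submodule ℝ (ι → ℝ)}
  {price : M →ₗ[ℝ] ℝ} {α : ι → ℝ}

lemma isBounded_setOf_le_and_sum_le (hα : ∀ i, 0 < α i) (m : ι → ℝ) (c : ℝ) :
    Bornology.IsBounded {z : ι → ℝ | m ≤ z ∧ ∑ i, α i * z i ≤ c} := by
  refine (Metric.isBounded_Icc m fun i => m i + (c - ∑ j, α j * m j) / α i).subset ?_
  rintro z ⟨hmz, hzc⟩
  refine ⟨hmz, fun i => ?_⟩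
  have hterm : α i * (z i - m i) ≤ ∑ j, α j * (z j - m j) :=
    Finset.single_le_sum (f := fun j => α j * (z j - m j))
      (fun j _ => mul_nonneg (hα j).le (sub_nonneg.2 (hmz j))) (Finset.mem_univ i)
  simp only [mul_sub (α _) (z _), Finset.sum_sub_distrib] at hterm
  rw [← sub_le_iff_le_add', le_div_iff₀ (hα i)]
  linarith

lemma isCompact_acceptable_payoffs (hA : IsClosed A) (hbdd : BddBelow A) (hα : ∀ i, 0 < α i)
    (hprice : ∀ z : M, price z = ∑ i, α i * (z : ι → ℝ) i) (x : ι → ℝ) (c : ℝ) :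
    IsCompact {z : M | (z : ι → ℝ) + x ∈ A ∧ price z ≤ c} := by
  obtain ⟨m, hm⟩ := hbdd
  refine Metric.isCompact_of_isClosed_isBounded ?_ ?_
  · exact (hA.preimage (continuous_subtype_val.add continuous_const)).inter
      (isClosed_le price.continuous_of_finiteDimensional continuous_const)
  · refine Bornology.isBounded_image_subtype_val.1
      ((isBounded_setOf_le_and_sum_le hα (m - x) c).subset ?_)
    rintro _ ⟨z, ⟨hzA, hzc⟩, rfl⟩
    exact ⟨sub_le_iff_le_add.2 (hm hzA), (hprice z).symm.trans_le hzc⟩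

lemma le_add_dist_smul_one (x y : ι → ℝ) : x ≤ y + dist x y • 1 := fun i => by
  have h : x i - y i ≤ dist x y :=
    ((le_abs_self _).trans_eq (Real.dist_eq _ _).symm).trans (dist_le_pi_dist x y i)
  simpa [sub_le_iff_le_add, add_comm] using h

theorem optimalSet_nonempty (hA : IsClosed A) (hup : IsUpperSet A) (hne : A.Nonempty)
    (hbdd : BddBelow A) (hM : 1 ∈ M) (hα : ∀ i, 0 < α i)
    (hprice : ∀ z : M, price z = ∑ i, α i * (z : ι → ℝ) i) (x : ι → ℝ) :
    (optimalSet A M price x).Nonempty := by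
  obtain ⟨a, ha⟩ := hne
  let z₀ : M := dist a x • ⟨1, hM⟩
  have hz₀ : (z₀ : ι → ℝ) + x ∈ A := hup ((le_add_dist_smul_one a x).trans_eq (add_comm _ _)) ha
  obtain ⟨z, ⟨hzA, hz⟩, hmin⟩ :=
    (isCompact_acceptable_payoffs hA hbdd hα hprice x (price z₀)).exists_isMinOn ⟨z₀, hz₀, le_rfl⟩
      price.continuous_of_finiteDimensional.continuousOn
  refine ⟨z, mem_optimalSet_iff.2 ⟨hzA, fun z' hz' => ?_⟩⟩
  rcases le_total (price z') (price z₀) with h | h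
  · exact hmin ⟨hz', h⟩
  · exact hz.trans h

theorem lipschitzWith_toReal_riskMeasure (hup : IsUpperSet A) (hM : 1 ∈ M)
    (hopt : ∀ x, (optimalSet A M price x).Nonempty) :
    LipschitzWith (price ⟨1, hM⟩).toNNReal fun x => (riskMeasure A M price x).toReal := by
  refine LipschitzWith.of_le_add_mul _ fun x y => ?_
  obtain ⟨z, hz⟩ := hopt x
  obtain ⟨z', hz'⟩ := hopt y
  have hshift : ((z' + dist x y • ⟨1, hM⟩ : M) : ι → ℝ) + x ∈ A := by
    refine hup ?_ (mem_optimalSet_iff.1 hz').1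
    calc (z' : ι → ℝ) + y ≤ z' + (x + dist y x • 1) := by gcongr; exact le_add_dist_smul_one y x
      _ = z' + dist x y • 1 + x := by rw [dist_comm, add_comm x, add_assoc]
  have hle := (mem_optimalSet_iff.1 hz).2 _ hshift
  rw [map_add, map_smul, smul_eq_mul] at hle
  rw [← hz.2, ← hz'.2, EReal.toReal_coe, EReal.toReal_coe]
  calc price z ≤ price z' + dist x y * price ⟨1, hM⟩ := hle
    _ ≤ price z' + (price ⟨1, hM⟩).toNNReal * dist x y := by
      rw [mul_comm]
      gcongr
      exact Real.le_coe_toNNReal _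

lemma price_pos_of_nonneg (hα : ∀ i, 0 < α i)
    (hprice : ∀ z : M, price z = ∑ i, α i * (z : ι → ℝ) i) {z : M} (hz : 0 ≤ (z : ι → ℝ))
    (hz0 : (z : ι → ℝ) ≠ 0) : 0 < price z := by
  obtain ⟨i, hi⟩ := Function.ne_iff.1 hz0
  rw [hprice]
  exact Finset.sum_pos' (fun j _ => mul_nonneg (hα j).le (hz j))
    ⟨i, Finset.mem_univ i, mul_pos (hα i) ((hz i).lt_of_ne' hi)⟩

theorem admissible_of_isUpperSet (hA : IsClosed A) (hconv : Convex ℝ A) (h0 : 0 ∈ A)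
    (hup : IsUpperSet A) (hbdd : BddBelow A) (hM : 1 ∈ M) (hα : ∀ i, 0 < α i)
    (hprice : ∀ z : M, price z = ∑ i, α i * (z : ι → ℝ) i) : Admissible A M price where
  isClosed := hA
  convex := hconv
  zero_mem := h0
  monotone _ hx _ hy := hup (sub_nonneg.1 hy) hx
  noArbitrage _ := price_pos_of_nonneg hα hprice
  finite x := by
    rw [← coe_toReal_riskMeasure (optimalSet_nonempty hA hup ⟨0, h0⟩ hbdd hM hα hprice x)]
    exact ⟨EReal.coe_ne_bot _, EReal.coe_ne_top _⟩
  continuous := by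
    have hopt := optimalSet_nonempty hA hup ⟨0, h0⟩ hbdd hM hα hprice
    exact (continuous_coe_real_ereal.comp
      (lipschitzWith_toReal_riskMeasure hup hM hopt).continuous).congr
        fun x => coe_toReal_riskMeasure (hopt x)

end StrictlyPositivePricing

section Concavity

lemma concaveOn_sqrt_add_mul {p q : ℝ} (hp : 0 ≤ p) (hq : 0 ≤ q) :
    ConcaveOn ℝ (Ici 0) fun t => √(p + q * t) := by
  have h := Real.strictConcaveOn_sqrt.concaveOn.comp_affineMap (AffineMap.lineMap p (p + q))
  refine (h.subset (fun t ht => ?_) (convex_Ici 0)).congr fun t _ => ?_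
  · rw [mem_preimage, AffineMap.lineMap_apply_ring', add_sub_cancel_left, mem_Ici]
    exact add_nonneg (mul_nonneg ht hq) hp
  · rw [Function.comp_apply, AffineMap.lineMap_apply_ring', add_sub_cancel_left, mul_comm,
      add_comm]

lemma convexOn_inv_of_concaveOn {E : Type*} [AddCommGroup E] [Module ℝ E] {s : Set E} {f : E → ℝ}
    (hf : ConcaveOn ℝ s f) (hpos : ∀ x ∈ s, 0 < f x) : ConvexOn ℝ s fun x => (f x)⁻¹ := by
  refine ⟨hf.1, fun x hx y hy a b ha hb hab => ?_⟩
  have hinv := (convexOn_zpow (𝕜 := ℝ) (-1)).2 (hpos x hx) (hpos y hy) ha hb hab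
  simp only [zpow_neg_one] at hinv
  have hcombo : 0 < a • f x + b • f y :=
    convex_Ioi (0 : ℝ) (hpos x hx) (hpos y hy) ha hb hab
  exact (inv_anti₀ hcombo (hf.2 hx hy ha hb hab)).trans hinv

/- `√(d + t) - √(1 + t) = -(1 - d) / (√(d + t) + √(1 + t))`, and the reciprocal of a positive
concave function is convex. -/
lemma concaveOn_sqrt_add_sub_sqrt_one_add {d : ℝ} (hd0 : 0 ≤ d) (hd1 : d ≤ 1) :
    ConcaveOn ℝ (Ici 0) fun t => √(d + t) - √(1 + t) := by
  have hsum : ConcaveOn ℝ (Ici 0) fun t : ℝ => √(d + t) + √(1 + t) := by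
    simpa only [one_mul, Pi.add_def] using
      (concaveOn_sqrt_add_mul hd0 zero_le_one).add (concaveOn_sqrt_add_mul zero_le_one zero_le_one)
  have hpos : ∀ t ∈ Ici (0 : ℝ), 0 < √(d + t) + √(1 + t) := fun t ht =>
    add_pos_of_nonneg_of_pos (Real.sqrt_nonneg _) (Real.sqrt_pos.2 (by linarith [mem_Ici.1 ht]))
  refine ((convexOn_inv_of_concaveOn hsum hpos).smul (sub_nonneg.2 hd1)).neg.congr fun t ht => ?_
  have hd := Real.sq_sqrt (add_nonneg hd0 (mem_Ici.1 ht))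
  have h1 := Real.sq_sqrt (add_nonneg zero_le_one (mem_Ici.1 ht))
  simp only [Pi.neg_apply, smul_eq_mul]
  rw [neg_eq_iff_eq_neg, mul_inv_eq_iff_eq_mul₀ (hpos t ht).ne']
  linear_combination hd - h1

lemma concaveOn_sqrt_add_mul_sub_mul_sqrt {p q m : ℝ} (hp : 0 ≤ p) (hpq : p ≤ q) (hm : 0 ≤ m)
    (hmq : m ≤ √q) : ConcaveOn ℝ (Ici 0) fun t => √(p + q * t) - m * √(1 + t) := by
  have hq : 0 ≤ q := hp.trans hpq
  have hd0 : 0 ≤ p / q := div_nonneg hp hq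
  have hfactor : q * (p / q) = p := mul_div_cancel_of_imp' fun h => le_antisymm (h ▸ hpq) hp
  have h := ((concaveOn_sqrt_add_mul hd0 zero_le_one).smul (sub_nonneg.2 hmq)).add
    ((concaveOn_sqrt_add_sub_sqrt_one_add hd0 (div_le_one_of_le₀ hpq hq)).smul hm)
  refine h.congr fun t _ => ?_
  have hsqrt : √(p + q * t) = √q * √(p / q + t) := by
    rw [← Real.sqrt_mul hq, mul_add, hfactor]
  simp only [Pi.add_apply, smul_eq_mul, one_mul, hsqrt]
  ring

end Concavity

section FourQuarters

variable {u v a b : ℝ}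

lemma neg_mem_fourQuarters_iff : (-u, -v) ∈ fourQuarters ↔ (u, v) ∈ fourQuarters := by
  have neg_mem : ∀ {u v : ℝ}, (u, v) ∈ fourQuarters → (-u, -v) ∈ fourQuarters := by
    rintro u v (((⟨h, ⟨h₁, h₂⟩, h₃, h₄⟩ | ⟨h, ⟨h₁, h₂⟩, h₃, h₄⟩) | ⟨h, ⟨h₁, h₂⟩, h₃, h₄⟩) |
      ⟨h, ⟨h₁, h₂⟩, h₃, h₄⟩)
    · exact Or.inl (Or.inr ⟨by linarith, ⟨by linarith, by linarith⟩, by linarith, by linarith⟩)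
    · exact Or.inr ⟨by linarith, ⟨by linarith, by linarith⟩, by linarith, by linarith⟩
    · exact Or.inl (Or.inl (Or.inl
        ⟨by linarith, ⟨by linarith, by linarith⟩, by linarith, by linarith⟩))
    · exact Or.inl (Or.inl (Or.inr
        ⟨by linarith, ⟨by linarith, by linarith⟩, by linarith, by linarith⟩))
  exact ⟨fun h => by simpa only [neg_neg] using neg_mem h, neg_mem⟩

lemma mem_fourQuarters_iff_of_nonneg (hv : 0 ≤ v) :
    (u, v) ∈ fourQuarters ↔
      (1 / 2 ≤ u ∧ (2 * (u - 1 / 2)) ^ 2 + v ^ 2 ≤ 1) ∨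
        (u ≤ 1 / 2 ∧ (2 / 3 * (u - 1 / 2)) ^ 2 + v ^ 2 ≤ 1) := by
  constructor
  · rintro (((⟨h, ⟨h₁, h₂⟩, h₃, h₄⟩ | ⟨h, ⟨h₁, h₂⟩, h₃, h₄⟩) | ⟨h, ⟨h₁, h₂⟩, h₃, h₄⟩) |
      ⟨h, ⟨h₁, h₂⟩, h₃, h₄⟩) <;> dsimp only at h h₁ h₂ h₃ h₄
    · exact Or.inl ⟨h₁, by linarith⟩
    · exact Or.inr ⟨h₂, by linarith⟩
    · obtain rfl : v = 0 := le_antisymm h₄ hv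
      exact Or.inr ⟨by linarith, by nlinarith⟩
    · obtain rfl : v = 0 := le_antisymm h₄ hv
      rcases le_total (1 / 2) u with hu | hu
      · exact Or.inl ⟨hu, by nlinarith⟩
      · exact Or.inr ⟨hu, by nlinarith⟩
  · rintro (⟨hu, h⟩ | ⟨hu, h⟩)
    · refine Or.inl (Or.inl (Or.inl ⟨?_, ⟨hu, ?_⟩, hv, ?_⟩)) <;> dsimp only <;> nlinarith
    · refine Or.inl (Or.inl (Or.inr ⟨?_, ⟨?_, hu⟩, hv, ?_⟩)) <;> dsimp only <;> nlinarith

lemma fourQuarters_subset_Icc : fourQuarters ⊆ Icc (-1, -1) (1, 1) := by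
  rintro ⟨u, v⟩ (((⟨-, ⟨h₁, h₂⟩, h₃, h₄⟩ | ⟨-, ⟨h₁, h₂⟩, h₃, h₄⟩) | ⟨-, ⟨h₁, h₂⟩, h₃, h₄⟩) |
    ⟨-, ⟨h₁, h₂⟩, h₃, h₄⟩) <;> dsimp only at h₁ h₂ h₃ h₄
  all_goals exact ⟨⟨by linarith, by linarith⟩, by linarith, by linarith⟩

lemma isCompact_fourQuarters : IsCompact fourQuarters := by
  have hquarter {f : ℝ × ℝ → ℝ} (hf : Continuous f) (I J : Set ℝ) (hI : IsClosed I)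
      (hJ : IsClosed J) : IsClosed {p : ℝ × ℝ | f p ≤ 1 ∧ p.1 ∈ I ∧ p.2 ∈ J} :=
    (isClosed_le hf continuous_const).inter
      ((hI.preimage continuous_fst).inter (hJ.preimage continuous_snd))
  refine isCompact_Icc.of_isClosed_subset ?_ fourQuarters_subset_Icc
  refine (((hquarter ?_ _ _ ?_ ?_).union (hquarter ?_ _ _ ?_ ?_)).union
    (hquarter ?_ _ _ ?_ ?_)).union (hquarter ?_ _ _ ?_ ?_)
  all_goals first | exact isClosed_Icc | fun_prop

lemma mul_add_mul_le_sqrt {x y : ℝ} (hxy : x ^ 2 + y ^ 2 ≤ 1) (a b : ℝ) :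
    a * x + b * y ≤ √(a ^ 2 + b ^ 2) := by
  refine Real.le_sqrt_of_sq_le ?_
  nlinarith [sq_nonneg (a * y - b * x),
    mul_nonneg (add_nonneg (sq_nonneg a) (sq_nonneg b)) (sub_nonneg.2 hxy)]

/-- The support function `(a, b) ↦ max {a u + b v ; (u, v) ∈ C}` of the set `C`. In direction
`(a, b)` the maximum is attained on an ellipse with horizontal semiaxis `1 / 2` when `a` and `b`
have the same sign, and on one with horizontal semiaxis `3 / 2` otherwise. -/
noncomputable def fourQuartersSupport (a b : ℝ) : ℝ :=
  if 0 ≤ a * b then (|a| + √(a ^ 2 + 4 * b ^ 2)) / 2 else (√(9 * a ^ 2 + 4 * b ^ 2) - |a|) / 2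

lemma fourQuartersSupport_of_mul_nonneg (h : 0 ≤ a * b) :
    fourQuartersSupport a b = (|a| + √(a ^ 2 + 4 * b ^ 2)) / 2 := if_pos h

lemma fourQuartersSupport_of_mul_nonpos (h : a * b ≤ 0) :
    fourQuartersSupport a b = (√(9 * a ^ 2 + 4 * b ^ 2) - |a|) / 2 := by
  rcases h.eq_or_lt with h0 | hneg
  · rw [fourQuartersSupport_of_mul_nonneg h0.ge]
    rcases mul_eq_zero.1 h0 with rfl | rfl
    · simp
    · have h9 : √(9 * a ^ 2) = 3 * |a| := by
        rw [show 9 * a ^ 2 = (3 * a) ^ 2 by ring, Real.sqrt_sq_eq_abs, abs_mul, abs_of_pos]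
        norm_num
      simp only [ne_eq, OfNat.ofNat_ne_zero, not_false_eq_true, zero_pow, mul_zero, add_zero, h9,
        Real.sqrt_sq_eq_abs]
      ring
  · exact if_neg hneg.not_ge

lemma fourQuartersSupport_neg_neg (a b : ℝ) :
    fourQuartersSupport (-a) (-b) = fourQuartersSupport a b := by
  simp only [fourQuartersSupport, neg_mul_neg, abs_neg, neg_sq]

lemma abs_le_fourQuartersSupport (a b : ℝ) : |a| ≤ fourQuartersSupport a b := by
  rcases le_total 0 (a * b) with h | h
  · rw [fourQuartersSupport_of_mul_nonneg h]
    linarith [Real.abs_le_sqrt (show a ^ 2 ≤ a ^ 2 + 4 * b ^ 2 by nlinarith)]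
  · rw [fourQuartersSupport_of_mul_nonpos h]
    have h9 := Real.abs_le_sqrt (show (3 * a) ^ 2 ≤ 9 * a ^ 2 + 4 * b ^ 2 by nlinarith)
    rw [abs_mul, abs_of_pos (by norm_num : (0 : ℝ) < 3)] at h9
    linarith

lemma mul_add_mul_le_fourQuartersSupport_of_nonneg (h : (u, v) ∈ fourQuarters) (hv : 0 ≤ v)
    (hb : 0 ≤ b) : a * u + b * v ≤ fourQuartersSupport a b := by
  have hv1 : v ≤ 1 := (fourQuarters_subset_Icc h).2.2
  rcases le_total 0 a with ha | ha
  · rw [fourQuartersSupport_of_mul_nonneg (mul_nonneg ha hb), abs_of_nonneg ha]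
    rcases (mem_fourQuarters_iff_of_nonneg hv).1 h with ⟨-, huv⟩ | ⟨hu, -⟩
    · have hcs := mul_add_mul_le_sqrt huv a (2 * b)
      rw [mul_pow 2 b] at hcs
      norm_num at hcs ⊢
      linarith
    · have h2b : 2 * b ≤ √(a ^ 2 + 4 * b ^ 2) := Real.le_sqrt_of_sq_le (by nlinarith)
      nlinarith
  · rw [fourQuartersSupport_of_mul_nonpos (mul_nonpos_of_nonpos_of_nonneg ha hb), abs_of_nonpos ha]
    rcases (mem_fourQuarters_iff_of_nonneg hv).1 h with ⟨hu, -⟩ | ⟨-, huv⟩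
    · have h2b : 2 * b ≤ √(9 * a ^ 2 + 4 * b ^ 2) := Real.le_sqrt_of_sq_le (by nlinarith)
      nlinarith
    · have hcs := mul_add_mul_le_sqrt huv (3 * a) (2 * b)
      rw [mul_pow 3 a, mul_pow 2 b] at hcs
      norm_num at hcs ⊢
      linarith

lemma mul_add_mul_le_fourQuartersSupport (h : (u, v) ∈ fourQuarters) (a b : ℝ) :
    a * u + b * v ≤ fourQuartersSupport a b := by
  wlog hb : 0 ≤ b generalizing u v a b
  · have hneg := this (neg_mem_fourQuarters_iff.2 h) (-a) (-b) (by linarith)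
    rwa [fourQuartersSupport_neg_neg, neg_mul_neg, neg_mul_neg] at hneg
  rcases le_total 0 v with hv | hv
  · exact mul_add_mul_le_fourQuartersSupport_of_nonneg h hv hb
  · have hu : |u| ≤ 1 :=
      abs_le.2 ⟨(fourQuarters_subset_Icc h).1.1, (fourQuarters_subset_Icc h).2.1⟩
    calc a * u + b * v ≤ |a| * 1 + 0 :=
          add_le_add ((le_abs_self _).trans_eq (abs_mul a u) |>.trans (by gcongr))
            (mul_nonpos_of_nonneg_of_nonpos hb hv)
      _ ≤ fourQuartersSupport a b := by
          rw [mul_one, add_zero]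
          exact abs_le_fourQuartersSupport a b

/- The half-planes normal to the ellipses at the radial projections of `(u, v)` suffice. -/
lemma mem_fourQuarters_iff_forall_le :
    (u, v) ∈ fourQuarters ↔ ∀ a b, a * u + b * v ≤ fourQuartersSupport a b := by
  refine ⟨mul_add_mul_le_fourQuartersSupport, fun h => ?_⟩
  wlog hv : 0 ≤ v generalizing u v
  · refine neg_mem_fourQuarters_iff.1 (this (fun a b => ?_) (by linarith))
    simpa only [fourQuartersSupport_neg_neg, neg_mul, mul_neg] using h (-a) (-b)
  rw [mem_fourQuarters_iff_of_nonneg hv]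
  rcases le_total (1 / 2) u with hu | hu
  · refine Or.inl ⟨hu, Real.le_sqrt_self_iff.1 ?_⟩
    have ha : 0 ≤ 4 * (u - 1 / 2) := by linarith
    have hdir := h (4 * (u - 1 / 2)) v
    rw [fourQuartersSupport_of_mul_nonneg (mul_nonneg ha hv), abs_of_nonneg ha,
      show (4 * (u - 1 / 2)) ^ 2 + 4 * v ^ 2 = 2 ^ 2 * ((2 * (u - 1 / 2)) ^ 2 + v ^ 2) by ring,
      Real.sqrt_mul (sq_nonneg 2), Real.sqrt_sq zero_le_two] at hdir
    linarith
  · refine Or.inr ⟨hu, Real.le_sqrt_self_iff.1 ?_⟩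
    have ha : 4 / 9 * (u - 1 / 2) ≤ 0 := by linarith
    have hdir := h (4 / 9 * (u - 1 / 2)) v
    rw [fourQuartersSupport_of_mul_nonpos (mul_nonpos_of_nonpos_of_nonneg ha hv), abs_of_nonpos ha,
      show 9 * (4 / 9 * (u - 1 / 2)) ^ 2 + 4 * v ^ 2 =
        2 ^ 2 * ((2 / 3 * (u - 1 / 2)) ^ 2 + v ^ 2) by ring,
      Real.sqrt_mul (sq_nonneg 2), Real.sqrt_sq zero_le_two] at hdir
    linarith

end FourQuarters

section TwistedSet

lemma concaveOn_fourQuartersSupport_mul_sqrt (a b : ℝ) :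
    ConcaveOn ℝ (Ici 0) fun s => fourQuartersSupport (a * √(1 + s)) (b * √s) := by
  have hsq₁ : ∀ s ∈ Ici (0 : ℝ), (a * √(1 + s)) ^ 2 = a ^ 2 * (1 + s) := fun s hs => by
    rw [mul_pow, Real.sq_sqrt (add_nonneg zero_le_one hs)]
  have hsq₂ : ∀ s ∈ Ici (0 : ℝ), (b * √s) ^ 2 = b ^ 2 * s := fun s hs => by
    rw [mul_pow, Real.sq_sqrt hs]
  have habs (s : ℝ) : |a * √(1 + s)| = |a| * √(1 + s) := by
    rw [abs_mul, abs_of_nonneg (Real.sqrt_nonneg _)]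
  have hmul (s : ℝ) : a * √(1 + s) * (b * √s) = a * b * (√(1 + s) * √s) := by ring
  have hsqrt (s : ℝ) : 0 ≤ √(1 + s) * √s := mul_nonneg (Real.sqrt_nonneg _) (Real.sqrt_nonneg _)
  rcases le_total 0 (a * b) with hab | hab
  · have hconc := (((concaveOn_sqrt_add_mul zero_le_one zero_le_one).smul (abs_nonneg a)).add
      (concaveOn_sqrt_add_mul (sq_nonneg a) (by positivity : 0 ≤ a ^ 2 + 4 * b ^ 2))).smul
      (by norm_num : (0 : ℝ) ≤ 1 / 2)
    refine hconc.congr fun s hs => ?_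
    rw [fourQuartersSupport_of_mul_nonneg (hmul s ▸ mul_nonneg hab (hsqrt s)), hsq₁ s hs, hsq₂ s hs,
      habs]
    simp only [Pi.add_apply, smul_eq_mul, one_mul]
    ring_nf
  · have hm : |a| ≤ √(9 * a ^ 2 + 4 * b ^ 2) := Real.abs_le_sqrt (by nlinarith)
    have hconc := (concaveOn_sqrt_add_mul_sub_mul_sqrt (by positivity : 0 ≤ 9 * a ^ 2)
      (by nlinarith : 9 * a ^ 2 ≤ 9 * a ^ 2 + 4 * b ^ 2) (abs_nonneg a) hm).smul
      (by norm_num : (0 : ℝ) ≤ 1 / 2)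
    refine hconc.congr fun s hs => ?_
    rw [fourQuartersSupport_of_mul_nonpos
      (hmul s ▸ mul_nonpos_of_nonpos_of_nonneg hab (hsqrt s)), hsq₁ s hs, hsq₂ s hs, habs]
    simp only [smul_eq_mul]
    ring_nf

variable {r : ℝ} {E : Set (ℝ × ℝ)} {h : ℝ → ℝ → ℝ}

lemma convex_of_mem_iff_forall_le (hE : ∀ u v, (u, v) ∈ E ↔ ∀ a b, a * u + b * v ≤ h a b) :
    Convex ℝ E := by
  rintro ⟨u₁, v₁⟩ h₁ ⟨u₂, v₂⟩ h₂ w₁ w₂ hw₁ hw₂ hw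
  refine (hE _ _).2 fun a b => ?_
  calc a * (w₁ * u₁ + w₂ * u₂) + b * (w₁ * v₁ + w₂ * v₂)
      = w₁ * (a * u₁ + b * v₁) + w₂ * (a * u₂ + b * v₂) := by ring
    _ ≤ h a b := convex_Iic (h a b) ((hE _ _).1 h₁ a b) ((hE _ _).1 h₂ a b) hw₁ hw₂ hw

lemma div_mem_of_mem_iff_forall_le (hE : ∀ u v, (u, v) ∈ E ↔ ∀ a b, a * u + b * v ≤ h a b)
    {x y p q : ℝ} (hp : p ≠ 0) (hq : q ≠ 0)
    (hxy : ∀ a b, a * x + b * y ≤ h (a * p) (b * q)) : (x / p, y / q) ∈ E := by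
  refine (hE _ _).2 fun a b => ?_
  have hdiv := hxy (a / p) (b / q)
  rwa [div_mul_cancel₀ a hp, div_mul_cancel₀ b hq, div_mul_eq_mul_div, div_mul_eq_mul_div,
    ← mul_div_assoc', ← mul_div_assoc'] at hdiv

/- For `s > 0` the image of `E` under `(u, v) ↦ (u √(1 + s), v √s)` has support function
`(a, b) ↦ h (a √(1 + s)) (b √s)`, so concavity in `s` says that the slice at a convex combination
contains the convex combination of the slices. -/
lemma exists_mem_of_concaveOn (hE : ∀ u v, (u, v) ∈ E ↔ ∀ a b, a * u + b * v ≤ h a b)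
    (hconc : ∀ a b, ConcaveOn ℝ (Ici 0) fun s => h (a * √(1 + s)) (b * √s))
    {u₁ v₁ s₁ u₂ v₂ s₂ w₁ w₂ : ℝ} (h₁ : (u₁, v₁) ∈ E) (h₂ : (u₂, v₂) ∈ E) (hs₁ : 0 ≤ s₁)
    (hs₂ : 0 ≤ s₂) (hw₁ : 0 ≤ w₁) (hw₂ : 0 ≤ w₂) (hw : w₁ + w₂ = 1) :
    ∃ u v, (u, v) ∈ E ∧
      w₁ * (u₁ * √(1 + s₁)) + w₂ * (u₂ * √(1 + s₂)) = u * √(1 + (w₁ * s₁ + w₂ * s₂)) ∧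
      w₁ * (v₁ * √s₁) + w₂ * (v₂ * √s₂) = v * √(w₁ * s₁ + w₂ * s₂) := by
  have hws₁ := mul_nonneg hw₁ hs₁
  have hws₂ := mul_nonneg hw₂ hs₂
  rcases (add_nonneg hws₁ hws₂).eq_or_lt with hs | hs
  · have hflat : ∀ {w s : ℝ}, w * s = 0 → w * √s = 0 ∧ w * √(1 + s) = w := by
      intro w s hws
      rcases mul_eq_zero.1 hws with rfl | rfl <;> simp
    obtain ⟨hv₁, hu₁⟩ := hflat (show w₁ * s₁ = 0 by linarith)
    obtain ⟨hv₂, hu₂⟩ := hflat (show w₂ * s₂ = 0 by linarith)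
    refine ⟨w₁ * u₁ + w₂ * u₂, w₁ * v₁ + w₂ * v₂,
      convex_of_mem_iff_forall_le hE h₁ h₂ hw₁ hw₂ hw, ?_, ?_⟩
    · rw [← hs, add_zero, Real.sqrt_one]
      linear_combination u₁ * hu₁ + u₂ * hu₂
    · rw [← hs, Real.sqrt_zero]
      linear_combination v₁ * hv₁ + v₂ * hv₂
  · have hp : √(1 + (w₁ * s₁ + w₂ * s₂)) ≠ 0 := (Real.sqrt_pos.2 (by linarith)).ne'
    have hq : √(w₁ * s₁ + w₂ * s₂) ≠ 0 := (Real.sqrt_pos.2 hs).ne'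
    refine ⟨_, _, div_mem_of_mem_iff_forall_le hE hp hq fun a b => ?_,
      (div_mul_cancel₀ _ hp).symm, (div_mul_cancel₀ _ hq).symm⟩
    calc a * (w₁ * (u₁ * √(1 + s₁)) + w₂ * (u₂ * √(1 + s₂))) +
          b * (w₁ * (v₁ * √s₁) + w₂ * (v₂ * √s₂))
        = w₁ * (a * √(1 + s₁) * u₁ + b * √s₁ * v₁) +
            w₂ * (a * √(1 + s₂) * u₂ + b * √s₂ * v₂) := by ring
      _ ≤ w₁ * h (a * √(1 + s₁)) (b * √s₁) + w₂ * h (a * √(1 + s₂)) (b * √s₂) :=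
          add_le_add (mul_le_mul_of_nonneg_left ((hE _ _).1 h₁ _ _) hw₁)
            (mul_le_mul_of_nonneg_left ((hE _ _).1 h₂ _ _) hw₂)
      _ ≤ h (a * √(1 + (w₁ * s₁ + w₂ * s₂))) (b * √(w₁ * s₁ + w₂ * s₂)) :=
          (hconc a b).2 hs₁ hs₂ hw₁ hw₂ hw

lemma convex_twistedSet (hr : 0 ≤ r) (hE : ∀ u v, (u, v) ∈ E ↔ ∀ a b, a * u + b * v ≤ h a b)
    (hconc : ∀ a b, ConcaveOn ℝ (Ici 0) fun s => h (a * √(1 + s)) (b * √s)) :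
    Convex ℝ (twistedSet r E) := by
  rintro _ ⟨u₁, v₁, t₁, h₁, ht₁, rfl⟩ _ ⟨u₂, v₂, t₂, h₂, ht₂, rfl⟩ w₁ w₂ hw₁ hw₂ hw
  obtain ⟨u, v, huv, hu, hv⟩ := exists_mem_of_concaveOn hE hconc h₁ h₂
    (mul_nonneg (sq_nonneg r) ht₁.1) (mul_nonneg (sq_nonneg r) ht₂.1) hw₁ hw₂ hw
  have hcombo : w₁ * (r ^ 2 * t₁) + w₂ * (r ^ 2 * t₂) = r ^ 2 * (w₁ * t₁ + w₂ * t₂) := by ring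
  have hsqrt (t : ℝ) : √(r ^ 2 * t) = r * √t := by
    rw [Real.sqrt_mul (sq_nonneg r), Real.sqrt_sq hr]
  rw [hcombo] at hu hv
  simp only [hsqrt, ← mul_assoc] at hv
  refine ⟨u, v, w₁ * t₁ + w₂ * t₂, huv, convex_Icc (0 : ℝ) 1 ht₁ ht₂ hw₁ hw₂ hw, ?_⟩
  simp only [Matrix.smul_cons, smul_eq_mul, Matrix.smul_empty, Matrix.cons_add_cons,
    Matrix.empty_add_empty, hu, ← hv, mul_assoc]

lemma isCompact_twistedSet (hE : IsCompact E) : IsCompact (twistedSet r E) := by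
  have hcont : Continuous fun q : (ℝ × ℝ) × ℝ =>
      ![q.1.1 * √(1 + r ^ 2 * q.2), q.1.2 * r * √q.2, q.2] := by fun_prop
  convert (hE.prod (isCompact_Icc (a := (0 : ℝ)) (b := 1))).image hcont using 1
  ext x
  constructor
  · rintro ⟨u, v, t, huv, ht, rfl⟩
    exact ⟨((u, v), t), ⟨huv, ht⟩, rfl⟩
  · rintro ⟨⟨⟨u, v⟩, t⟩, ⟨huv, ht⟩, rfl⟩
    exact ⟨u, v, t, huv, ht, rfl⟩

end TwistedSet

section Rotation

lemma rotationPhi_apply (w : Fin 3 → ℝ) :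
    rotationPhi w = ![w 0 / √2 + w 1 / √6 + w 2 / √3, -(w 0 / √2) + w 1 / √6 + w 2 / √3,
      -(2 * (w 1 / √6)) + w 2 / √3] := by
  have h6 : √2 / √3 = 2 / √6 := by
    rw [div_eq_div_iff (by positivity) (by positivity), ← Real.sqrt_mul zero_le_two,
      show (2 * 6 : ℝ) = 2 ^ 2 * 3 by norm_num, Real.sqrt_mul (sq_nonneg 2),
      Real.sqrt_sq zero_le_two]
  rw [rotationPhi, h6, Matrix.toLin'_apply]
  ext i
  fin_cases i <;>
    simp only [Matrix.mulVec, dotProduct, Fin.sum_univ_three, Matrix.of_apply, Matrix.cons_val,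
      Fin.zero_eta, Fin.mk_one, Fin.reduceFinMk] <;>
    ring

lemma continuous_rotationPhi : Continuous rotationPhi :=
  rotationPhi.continuous_of_finiteDimensional

lemma sum_rotationPhi (w : Fin 3 → ℝ) : ∑ i, rotationPhi w i = √3 * w 2 := by
  have h3 : 3 / √3 = √3 := by rw [div_eq_iff (by positivity), Real.mul_self_sqrt zero_le_three]
  rw [rotationPhi_apply, Fin.sum_univ_three]
  simp only [Matrix.cons_val]
  linear_combination w 2 * h3

lemma sum_sq_rotationPhi (w : Fin 3 → ℝ) : ∑ i, rotationPhi w i ^ 2 = ∑ i, w i ^ 2 := by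
  have hsq {c : ℝ} (hc : 0 < c) (y : ℝ) : (y / √c) ^ 2 = y ^ 2 / c := by
    rw [div_pow, Real.sq_sqrt hc.le]
  rw [rotationPhi_apply, Fin.sum_univ_three, Fin.sum_univ_three]
  simp only [Matrix.cons_val]
  linear_combination 2 * hsq two_pos (w 0) + 6 * hsq (by norm_num : (0 : ℝ) < 6) (w 1) +
    3 * hsq three_pos (w 2)

lemma rotationPhi_injective : Function.Injective rotationPhi := by
  refine (injective_iff_map_eq_zero _).2 fun w hw => funext fun i => ?_
  have hsum : ∑ j, w j ^ 2 = 0 := by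
    rw [← sum_sq_rotationPhi, hw]
    exact Finset.sum_eq_zero fun _ _ => zero_pow two_ne_zero
  exact pow_eq_zero_iff two_ne_zero |>.1
    (congrFun ((Fintype.sum_eq_zero_iff_of_nonneg fun j => sq_nonneg (w j)).1 hsum) i)

/- The orthant lies in the circular cone `∑ pᵢ² ≤ (∑ pᵢ)²` around its diagonal, which `Φ⁻¹` turns
into the third axis. -/
lemma nonneg_and_sq_add_sq_le_of_nonneg_rotationPhi {k : Fin 3 → ℝ} (hk : 0 ≤ rotationPhi k) :
    0 ≤ k 2 ∧ k 0 ^ 2 + k 1 ^ 2 ≤ 2 * k 2 ^ 2 := by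
  have hsum : 0 ≤ √3 * k 2 :=
    (Finset.sum_nonneg fun i _ => hk i).trans_eq (sum_rotationPhi k)
  have hsq := Finset.sum_sq_le_sq_sum_of_nonneg (s := Finset.univ) fun i _ => hk i
  rw [sum_sq_rotationPhi, sum_rotationPhi, Fin.sum_univ_three, mul_pow,
    Real.sq_sqrt zero_le_three] at hsq
  exact ⟨nonneg_of_mul_nonneg_right hsum (by positivity), by linarith⟩

end Rotation

section Example

lemma mem_payoffSpace_iff {z : Fin 3 → ℝ} :
    z ∈ payoffSpace ↔ ∃ a c : ℝ, rotationPhi ![a, 0, c] = z := by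
  constructor
  · rintro ⟨w, hw, rfl⟩
    refine ⟨w 0, w 2, congrArg _ ?_⟩
    ext i
    fin_cases i
    · rfl
    · exact hw.symm
    · rfl
  · rintro ⟨a, c, rfl⟩
    exact ⟨_, rfl, rfl⟩

lemma pricing_eq {z : payoffSpace} {a c : ℝ} (hz : rotationPhi ![a, 0, c] = z) :
    pricing z = c / √3 := by
  rw [show pricing z = (z : Fin 3 → ℝ) 2 from rfl, ← hz, rotationPhi_apply]
  simp only [Matrix.cons_val, zero_div, mul_zero, neg_zero, zero_add]

lemma pricing_eq_sum (z : payoffSpace) :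
    pricing z = ∑ i, (1 / 3 : ℝ) * (z : Fin 3 → ℝ) i := by
  obtain ⟨a, c, hz⟩ := mem_payoffSpace_iff.1 z.2
  rw [pricing_eq hz, ← Finset.mul_sum, ← hz, sum_rotationPhi, div_eq_iff (by positivity)]
  simp only [Matrix.cons_val]
  linear_combination -c / 3 * Real.mul_self_sqrt zero_le_three

lemma one_mem_payoffSpace : 1 ∈ payoffSpace := by
  refine mem_payoffSpace_iff.2 ⟨0, √3, ?_⟩
  rw [rotationPhi_apply]
  ext i
  fin_cases i <;> simp

lemma isClosed_acceptanceSet : IsClosed acceptanceSet :=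
  isClosed_Ici.add_left_of_isCompact
    ((isCompact_twistedSet isCompact_fourQuarters).image continuous_rotationPhi)

lemma convex_acceptanceSet : Convex ℝ acceptanceSet :=
  ((convex_twistedSet (by norm_num) (fun _ _ => mem_fourQuarters_iff_forall_le)
    concaveOn_fourQuartersSupport_mul_sqrt).linear_image rotationPhi).add (convex_Ici 0)

lemma isUpperSet_acceptanceSet : IsUpperSet acceptanceSet :=
  (isUpperSet_Ici 0).add_left

lemma bddBelow_acceptanceSet : BddBelow acceptanceSet :=
  ((isCompact_twistedSet isCompact_fourQuarters).image
    continuous_rotationPhi).isBounded.bddBelow.add bddBelow_Ici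

lemma zero_mem_acceptanceSet : 0 ∈ acceptanceSet := by
  have hC : (0, 0) ∈ fourQuarters :=
    (mem_fourQuarters_iff_of_nonneg le_rfl).2 (Or.inr (by norm_num))
  refine ⟨0, ⟨0, ⟨0, 0, 0, hC, by simp, ?_⟩, map_zero _⟩, 0, le_refl (0 : Fin 3 → ℝ), add_zero _⟩
  ext i
  fin_cases i <;> simp

theorem admissible_acceptanceSet : Admissible acceptanceSet payoffSpace pricing :=
  admissible_of_isUpperSet isClosed_acceptanceSet convex_acceptanceSet zero_mem_acceptanceSet
    isUpperSet_acceptanceSet bddBelow_acceptanceSet one_mem_payoffSpace (by norm_num) pricing_eq_sum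

theorem optimalSet_acceptanceSet_nonempty (x : Fin 3 → ℝ) :
    (optimalSet acceptanceSet payoffSpace pricing x).Nonempty :=
  optimalSet_nonempty isClosed_acceptanceSet isUpperSet_acceptanceSet ⟨0, zero_mem_acceptanceSet⟩
    bddBelow_acceptanceSet one_mem_payoffSpace (by norm_num) pricing_eq_sum x

end Example

section OptimalPayoffs

lemma mk_mem_fourQuarters_iff_of_abs_eq_one {u ε : ℝ} (hε : |ε| = 1) :
    (u, ε) ∈ fourQuarters ↔ u = ε / 2 := by
  have htop {u : ℝ} : (u, 1) ∈ fourQuarters ↔ u = 1 / 2 := by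
    rw [mem_fourQuarters_iff_of_nonneg zero_le_one]
    constructor
    · rintro (⟨-, h⟩ | ⟨-, h⟩) <;> nlinarith
    · rintro rfl
      norm_num
  rcases eq_or_eq_neg_of_abs_eq hε with rfl | rfl
  · exact htop
  · rw [← neg_mem_fourQuarters_iff, neg_neg, htop, neg_eq_iff_eq_neg, neg_div]

lemma exists_mem_of_rotationPhi_mem_add {B : Set (Fin 3 → ℝ)} {w : Fin 3 → ℝ}
    (hw : rotationPhi w ∈ rotationPhi '' B + {p | 0 ≤ p}) :
    ∃ b ∈ B, b 2 ≤ w 2 ∧ (w 0 - b 0) ^ 2 + (w 1 - b 1) ^ 2 ≤ 2 * (w 2 - b 2) ^ 2 := by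
  obtain ⟨_, ⟨b, hb, rfl⟩, p, hp, hw⟩ := hw
  have hk : 0 ≤ rotationPhi (w - b) := by
    rw [map_sub, ← hw, add_sub_cancel_left]
    exact hp
  exact ⟨b, hb, (nonneg_and_sq_add_sq_le_of_nonneg_rotationPhi hk).imp_left sub_nonneg.1⟩

/- `τ - t = (√τ - √t) (√τ + √t) < 2 (√τ - √t)` when `t < τ ≤ 1`. -/
lemma le_or_lt_of_two_mul_sqrt_sub_sqrt_le {τ t c : ℝ} (hτ : τ ≤ 1) (ht : 0 ≤ t)
    (h : 2 * (√τ - √t) ≤ c - t) : τ ≤ t ∨ τ < c := by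
  refine or_iff_not_imp_left.2 fun hlt => ?_
  rw [not_le] at hlt
  have hroots : √t < √τ := Real.sqrt_lt_sqrt ht hlt
  have hroot : √τ ≤ 1 := Real.sqrt_le_one.2 hτ
  nlinarith [Real.sq_sqrt ht, Real.sq_sqrt (ht.trans hlt.le)]

variable {r a c ε τ : ℝ}

lemma sqrt_sub_sqrt_le_abs_sub {v : ℝ} (hε : |ε| = 1) (hv : |v| ≤ 1) (τ t : ℝ) :
    √τ - √t ≤ |ε * √τ - v * √t| :=
  calc √τ - √t ≤ |ε * √τ| - |v * √t| := by
        rw [abs_mul, abs_mul, hε, one_mul, abs_of_nonneg (Real.sqrt_nonneg τ),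
          abs_of_nonneg (Real.sqrt_nonneg t)]
        exact sub_le_sub_left (mul_le_of_le_one_left (Real.sqrt_nonneg t) hv) _
    _ ≤ |ε * √τ - v * √t| := abs_sub_abs_le_abs_sub _ _

lemma exists_of_rotationPhi_mem_twistedSet_add {E : Set (ℝ × ℝ)} (hr : 8 ≤ r ^ 2)
    (h : rotationPhi ![a, ε * (r * √τ), c] ∈ rotationPhi '' twistedSet r E + {p | 0 ≤ p}) :
    ∃ u v t, (u, v) ∈ E ∧ 0 ≤ t ∧ t ≤ c ∧ 2 * |ε * √τ - v * √t| ≤ c - t ∧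
      (a - u * √(1 + r ^ 2 * t)) ^ 2 ≤ 2 * (c - t) ^ 2 := by
  obtain ⟨_, ⟨u, v, t, huv, ⟨ht0, -⟩, rfl⟩, htc, hcone⟩ := exists_mem_of_rotationPhi_mem_add h
  simp only [Matrix.cons_val] at htc hcone
  rw [show ε * (r * √τ) - v * r * √t = r * (ε * √τ - v * √t) by ring, mul_pow] at hcone
  refine ⟨u, v, t, huv, ht0, htc, ?_, le_of_add_le_of_nonneg_left hcone (by positivity)⟩
  rw [← abs_two, ← abs_mul]
  refine abs_le_of_sq_le_sq ?_ (sub_nonneg.2 htc)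
  nlinarith [sq_nonneg (a - u * √(1 + r ^ 2 * t)), sq_nonneg (ε * √τ - v * √t)]

lemma le_and_eq_of_rotationPhi_mem_twistedSet_add (hr : 8 ≤ r ^ 2) (hε : |ε| = 1)
    (hτ0 : 0 < τ) (hτ1 : τ ≤ 1)
    (h : rotationPhi ![a, ε * (r * √τ), c] ∈
      rotationPhi '' twistedSet r fourQuarters + {p | 0 ≤ p}) :
    τ ≤ c ∧ (c = τ → a = ε / 2 * √(1 + r ^ 2 * τ)) := by
  obtain ⟨u, v, t, huv, ht0, htc, hshift, hpayoff⟩ := exists_of_rotationPhi_mem_twistedSet_add hr h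
  obtain ⟨⟨-, hv₁⟩, -, hv₂⟩ := fourQuarters_subset_Icc huv
  have hroots : 2 * (√τ - √t) ≤ c - t :=
    (mul_le_mul_of_nonneg_left (sqrt_sub_sqrt_le_abs_sub hε (abs_le.2 ⟨hv₁, hv₂⟩) τ t)
      zero_le_two).trans hshift
  rcases le_or_lt_of_two_mul_sqrt_sub_sqrt_le hτ1 ht0 hroots with hτt | hτc
  · refine ⟨hτt.trans htc, ?_⟩
    rintro rfl
    obtain rfl : t = c := le_antisymm htc hτt
    have hvε : v = ε := by
      have hzero : (ε - v) * √t = 0 := by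
        rw [← abs_eq_zero, sub_mul]
        exact le_antisymm (by linarith) (abs_nonneg _)
      linarith [(mul_eq_zero.1 hzero).resolve_right (Real.sqrt_pos.2 hτ0).ne']
    have hua : a - u * √(1 + r ^ 2 * t) = 0 :=
      pow_eq_zero_iff two_ne_zero |>.1 (le_antisymm (by linarith) (sq_nonneg _))
    rw [← (mk_mem_fourQuarters_iff_of_abs_eq_one hε).1 (hvε ▸ huv)]
    exact sub_eq_zero.1 hua
  · exact ⟨hτc.le, fun hc => absurd hc hτc.ne'⟩

lemma rotationPhi_mem_twistedSet_add (hε : |ε| = 1) (hτ0 : 0 ≤ τ) (hτ1 : τ ≤ 1) :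
    rotationPhi ![ε / 2 * √(1 + r ^ 2 * τ), ε * (r * √τ), τ] ∈
      rotationPhi '' twistedSet r fourQuarters + {p | 0 ≤ p} :=
  ⟨_, ⟨_, ⟨ε / 2, ε, τ, (mk_mem_fourQuarters_iff_of_abs_eq_one hε).2 rfl, ⟨hτ0, hτ1⟩, rfl⟩, rfl⟩, 0,
    le_refl (0 : Fin 3 → ℝ), by rw [← mul_assoc]; exact add_zero _⟩

theorem optimalSet_twistedSet_add (hr : 8 ≤ r ^ 2) (hε : |ε| = 1) (hτ0 : 0 < τ) (hτ1 : τ ≤ 1) :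
    Subtype.val '' optimalSet (rotationPhi '' twistedSet r fourQuarters + {p | 0 ≤ p}) payoffSpace
        pricing (rotationPhi ![0, ε * (r * √τ), 0]) =
      {rotationPhi ![ε / 2 * √(1 + r ^ 2 * τ), 0, τ]} := by
  have hadd (a c : ℝ) : rotationPhi ![a, 0, c] + rotationPhi ![0, ε * (r * √τ), 0] =
      rotationPhi ![a, ε * (r * √τ), c] := by
    rw [← map_add]
    simp only [Matrix.cons_add_cons, Matrix.empty_add_empty, add_zero, zero_add]
  have hprice {z z' : payoffSpace} {a c a' c' : ℝ} (hz : rotationPhi ![a, 0, c] = z)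
      (hz' : rotationPhi ![a', 0, c'] = z') : pricing z ≤ pricing z' ↔ c ≤ c' := by
    rw [pricing_eq hz, pricing_eq hz', div_le_div_iff_of_pos_right (by positivity)]
  let z₀ : payoffSpace :=
    ⟨rotationPhi ![ε / 2 * √(1 + r ^ 2 * τ), 0, τ], mem_payoffSpace_iff.2 ⟨_, _, rfl⟩⟩
  have hz₀ : (z₀ : Fin 3 → ℝ) + rotationPhi ![0, ε * (r * √τ), 0] ∈
      rotationPhi '' twistedSet r fourQuarters + {p | 0 ≤ p} :=
    (hadd _ _).symm ▸ rotationPhi_mem_twistedSet_add hε hτ0.le hτ1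
  refine Subset.antisymm ?_ (singleton_subset_iff.2 ⟨z₀, mem_optimalSet_iff.2 ⟨hz₀, ?_⟩, rfl⟩)
  · rintro _ ⟨z, hz, rfl⟩
    obtain ⟨hzA, hmin⟩ := mem_optimalSet_iff.1 hz
    obtain ⟨a, c, hac⟩ := mem_payoffSpace_iff.1 z.2
    obtain ⟨hτc, ha⟩ :=
      le_and_eq_of_rotationPhi_mem_twistedSet_add hr hε hτ0 hτ1 (hadd a c ▸ hac ▸ hzA)
    have hc : c = τ := le_antisymm ((hprice hac rfl).1 (hmin z₀ hz₀)) hτc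
    rw [mem_singleton_iff, ← hac, ha hc, hc]
  · intro z hzA
    obtain ⟨a, c, hac⟩ := mem_payoffSpace_iff.1 z.2
    exact (hprice rfl hac).2
      (le_and_eq_of_rotationPhi_mem_twistedSet_add hr hε hτ0 hτ1 (hadd a c ▸ hac ▸ hzA)).1

end OptimalPayoffs

section Discontinuity

variable {n : ℕ}

lemma perturbation_two_mul (n : ℕ) : perturbation (2 * n) = ![0, 16 * √(1 / n), 0] := by
  rw [perturbation, if_pos (even_two_mul n), Nat.cast_mul, Nat.cast_ofNat,
    mul_div_cancel_left₀ _ two_ne_zero, Real.sqrt_div zero_le_one, Real.sqrt_one, mul_one_div]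

lemma perturbation_two_mul_sub_one (hn : 1 ≤ n) :
    perturbation (2 * n - 1) = ![0, -(16 * √(1 / n)), 0] := by
  have hodd : ¬ Even (2 * n - 1) := Nat.not_even_iff_odd.2 ⟨n - 1, by omega⟩
  have hhalf : (((2 * n - 1 : ℕ) : ℝ) + 1) / 2 = n := by
    rw [← Nat.cast_add_one, Nat.sub_add_cancel (by omega), Nat.cast_mul, Nat.cast_ofNat,
      mul_div_cancel_left₀ _ two_ne_zero]
  rw [perturbation, if_neg hodd, hhalf, Real.sqrt_div zero_le_one, Real.sqrt_one, mul_one_div]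

theorem optimalSet_perturbation_two_mul (hn : 1 ≤ n) :
    Subtype.val '' optimalSet acceptanceSet payoffSpace pricing
        (rotationPhi (perturbation (2 * n))) =
      {rotationPhi ![(1 / 2) * √(1 + 16 ^ 2 / (n : ℝ)), 0, 1 / (n : ℝ)]} := by
  have hn' : (1 : ℝ) ≤ n := Nat.one_le_cast.2 hn
  rw [perturbation_two_mul, ← one_mul (16 * √_), ← mul_one_div (16 ^ 2) (n : ℝ)]
  exact optimalSet_twistedSet_add (by norm_num) abs_one (by positivity)
    (div_le_one_of_le₀ hn' (by positivity))

theorem optimalSet_perturbation_two_mul_sub_one (hn : 1 ≤ n) :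
    Subtype.val '' optimalSet acceptanceSet payoffSpace pricing
        (rotationPhi (perturbation (2 * n - 1))) =
      {rotationPhi ![-(1 / 2) * √(1 + 16 ^ 2 / (n : ℝ)), 0, 1 / (n : ℝ)]} := by
  have hn' : (1 : ℝ) ≤ n := Nat.one_le_cast.2 hn
  rw [perturbation_two_mul_sub_one hn, neg_eq_neg_one_mul (16 * √_), ← neg_div,
    ← mul_one_div (16 ^ 2) (n : ℝ)]
  exact optimalSet_twistedSet_add (by norm_num) (by norm_num) (by positivity)
    (div_le_one_of_le₀ hn' (by positivity))

lemma tendsto_rotationPhi_perturbation :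
    Tendsto (fun k => rotationPhi (perturbation k)) atTop (𝓝 0) := by
  have hsize {c : ℝ} : Tendsto (fun k : ℕ => 16 / √(((k : ℝ) + c) / 2)) atTop (𝓝 0) :=
    tendsto_const_nhds.div_atTop (Real.tendsto_sqrt_atTop.comp
      ((tendsto_atTop_add_const_right _ c tendsto_natCast_atTop_atTop).atTop_div_const two_pos))
  have hcont : Continuous fun y : ℝ => rotationPhi ![0, y, 0] :=
    continuous_rotationPhi.comp (by fun_prop)
  have h0 : rotationPhi ![0, 0, 0] = 0 := by
    rw [← map_zero rotationPhi]
    congr 1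
    ext i
    fin_cases i <;> rfl
  have hpos := (hcont.tendsto' 0 0 h0).comp (hsize (c := 0))
  have hneg := (hcont.tendsto' 0 0 h0).comp (neg_zero (G := ℝ) ▸ (hsize (c := 1)).neg)
  refine (hpos.if' (p := Even) hneg).congr fun k => ?_
  rw [perturbation, apply_ite rotationPhi, Function.comp_apply, add_zero]
  rfl

lemma tendsto_rotationPhi_payoff (a : ℝ) :
    Tendsto (fun n : ℕ => rotationPhi ![a * √(1 + 16 ^ 2 / (n : ℝ)), 0, 1 / (n : ℝ)]) atTop
      (𝓝 (rotationPhi ![a, 0, 0])) := by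
  have hcont : Continuous fun y : ℝ => rotationPhi ![a * √(1 + 16 ^ 2 * y), 0, y] :=
    continuous_rotationPhi.comp (by fun_prop)
  refine ((hcont.tendsto' 0 (rotationPhi ![a, 0, 0]) (by simp)).comp
    tendsto_one_div_atTop_nhds_zero_nat).congr fun n => ?_
  rw [Function.comp_apply, mul_one_div]

lemma rotationPhi_neg_half_ne_half :
    rotationPhi ![-(1 / 2), 0, 0] ≠ rotationPhi ![1 / 2, 0, 0] := by
  refine rotationPhi_injective.ne fun h => ?_
  have h0 := congrFun h 0
  norm_num at h0

theorem not_continuousAt_zero_of_isSelection {s : (Fin 3 → ℝ) → payoffSpace}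
    (hs : IsSelection (optimalSet acceptanceSet payoffSpace pricing) s) : ¬ ContinuousAt s 0 := by
  intro hcont
  have heven : Tendsto (fun n : ℕ => 2 * n) atTop atTop := tendsto_id.const_mul_atTop' two_pos
  have hodd : Tendsto (fun n : ℕ => 2 * n - 1) atTop atTop :=
    (tendsto_sub_atTop_nat 1).comp heven
  have hlim₁ := hs.apply_eq_of_tendsto hcont continuousAt_subtype_val
    (tendsto_rotationPhi_perturbation.comp hodd) (tendsto_rotationPhi_payoff (-(1 / 2)))
    ((eventually_ge_atTop 1).mono fun n hn => (optimalSet_perturbation_two_mul_sub_one hn).subset)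
  have hlim₂ := hs.apply_eq_of_tendsto hcont continuousAt_subtype_val
    (tendsto_rotationPhi_perturbation.comp heven) (tendsto_rotationPhi_payoff (1 / 2))
    ((eventually_ge_atTop 1).mono fun n hn => (optimalSet_perturbation_two_mul hn).subset)
  exact rotationPhi_neg_half_ne_half (hlim₁.symm.trans hlim₂)

end Discontinuity

end RiskSelection

theorem mainTheorem2 :
    -- the triple is admissible, and its (finite) optimal value function is Lipschitz
    Admissible acceptanceSet payoffSpace pricing ∧
    (∃ K : NNReal, LipschitzWith K
      (fun x => (riskMeasure acceptanceSet payoffSpace pricing x).toReal)) ∧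
    -- optimal payoffs exist for every position, so that selections exist
    (∀ x, (optimalSet acceptanceSet payoffSpace pricing x).Nonempty) ∧
    -- along the sequence `Φ(y^(k)) → 0` the sets of optimal payoffs are explicit singletons,
    -- which converge to two different limits
    Filter.Tendsto (fun k => rotationPhi (perturbation k)) Filter.atTop (nhds 0) ∧
    (∀ n : ℕ, 1 ≤ n →
      Subtype.val '' optimalSet acceptanceSet payoffSpace pricing
          (rotationPhi (perturbation (2 * n - 1))) =
        {rotationPhi ![-(1 / 2) * √(1 + 16 ^ 2 / (n : ℝ)), 0, 1 / (n : ℝ)]}) ∧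
    (∀ n : ℕ, 1 ≤ n →
      Subtype.val '' optimalSet acceptanceSet payoffSpace pricing
          (rotationPhi (perturbation (2 * n))) =
        {rotationPhi ![(1 / 2) * √(1 + 16 ^ 2 / (n : ℝ)), 0, 1 / (n : ℝ)]}) ∧
    Filter.Tendsto
      (fun n : ℕ => rotationPhi ![-(1 / 2) * √(1 + 16 ^ 2 / (n : ℝ)), 0, 1 / (n : ℝ)])
      Filter.atTop (nhds (rotationPhi ![-(1 / 2), 0, 0])) ∧
    Filter.Tendsto
      (fun n : ℕ => rotationPhi ![(1 / 2) * √(1 + 16 ^ 2 / (n : ℝ)), 0, 1 / (n : ℝ)])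
      Filter.atTop (nhds (rotationPhi ![1 / 2, 0, 0])) ∧
    rotationPhi ![-(1 / 2), 0, 0] ≠ rotationPhi ![1 / 2, 0, 0] ∧
    -- no selection of the optimal set mapping is continuous at `0`
    (∀ s : (Fin 3 → ℝ) → payoffSpace,
      IsSelection (optimalSet acceptanceSet payoffSpace pricing) s → ¬ ContinuousAt s 0) :=
  ⟨admissible_acceptanceSet,
    ⟨_, lipschitzWith_toReal_riskMeasure isUpperSet_acceptanceSet one_mem_payoffSpace
      optimalSet_acceptanceSet_nonempty⟩,
    optimalSet_acceptanceSet_nonempty,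
    tendsto_rotationPhi_perturbation,
    fun _ => optimalSet_perturbation_two_mul_sub_one,
    fun _ => optimalSet_perturbation_two_mul,
    tendsto_rotationPhi_payoff _,
    tendsto_rotationPhi_payoff _,
    rotationPhi_neg_half_ne_half,
    fun _ => not_continuousAt_zero_of_isSelection⟩
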